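/- Let $d\ge 1$ and write $\langle x\rangle=\sqrt{1+|x|^2}$, $p=-i\nabla$. Let $\Psi:[0,\infty)\to\mathbb R$ and $V:\mathbb R^d\to\mathbb R$ satisfy: 1. $\Psi\in C^1(0,\infty)$, $\Psi\ge 0$, $\Psi'\ge 0$, and $\lim_{u\downarrow 0}\Psi(u)=\Psi(0)=0$; 2. there are constants $c_2,d_2\ge 0$ such that $u\Psi'(u)\le c_2\Psi(u)+d_2$ for all $u>0$; 3. $\mu>0$ is a constant such that $2u\Psi'(u)\ge \mu\Psi(u)$ for all $u>0$; 4. $V\in C^1(\mathbb R^d)$ and there are constants $c,\gamma>0$ such that $|V(x)|\le c\langle x\rangle^{-\gamma}$ and $|\nabla V(x)|\le c\langle x\rangle^{-1-\gamma}$ for all $x\in\mathbb R^d$. Let $H_0=\Psi(p^2/2)$ be the operator in $L^2(\mathbb R^d)$ that acts as multiplication by $\Psi(|\xi|^2/2)$ in Fourier space (where $p$ acts as multiplication by $\xi$), with its maximal domain $\mathrm{Dom}(H_0)$, and let $H=H_0+V$ with $\mathrm{Dom}(H)=\mathrm{Dom}(H_0)$. If $$-\mu V(x)-x\cdot\nabla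 V(x)\ge 0\qquad\text{for all }x\in\mathbb R^d,$$ with the same $\mu$ as in 3, then $H$ has no positive eigenvalue: there are no $E>0$ and $0\ne\psi\in\mathrm{Dom}(H)$ with $H\psi=E\psi$. -/

import Mathlib

open MeasureTheory Filter Topology Set

noncomputable section

namespace NonlocalSchrodinger

/-- Euclidean space `ℝᵈ`. -/
abbrev Space (d : ℕ) : Type := EuclideanSpace ℝ (Fin d)

/-- The complex Hilbert space `L²(ℝᵈ)` with respect to Lebesgue measure. -/
abbrev L2 (d : ℕ) : Type := Lp ℂ 2 (volume : Measure (Space d))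

/-- The bracket `⟨x⟩ = √(1 + |x|²)`. -/
def bracket {d : ℕ} (x : Space d) : ℝ := Real.sqrt (1 + ‖x‖ ^ 2)

theorem mul_zero_ae {d : ℕ} (g : Space d → ℝ) :
    (fun _ => 0) =ᵐ[volume] fun x => (g x : ℂ) * (0 : L2 d) x := by
  filter_upwards [Lp.coeFn_zero ℂ 2 (volume : Measure (Space d))] with x hx
  rw [hx, Pi.zero_apply, mul_zero]

theorem mul_add_ae {d : ℕ} (g : Space d → ℝ) (ψ φ : L2 d) :
    ((fun x => (g x : ℂ) * ψ x) + fun x => (g x : ℂ) * φ x) =ᵐ[volume]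
      fun x => (g x : ℂ) * (ψ + φ : L2 d) x := by
  filter_upwards [Lp.coeFn_add ψ φ] with x hx
  rw [hx, Pi.add_apply, Pi.add_apply, mul_add]

theorem mul_smul_ae {d : ℕ} (g : Space d → ℝ) (c : ℂ) (ψ : L2 d) :
    (c • fun x => (g x : ℂ) * ψ x) =ᵐ[volume] fun x => (g x : ℂ) * (c • ψ : L2 d) x := by
  filter_upwards [Lp.coeFn_smul c ψ] with x hx
  rw [hx, Pi.smul_apply, Pi.smul_apply, smul_eq_mul, smul_eq_mul, mul_left_comm]

/-- The maximal domain of multiplication by `g` in `L²(ℝᵈ)`: all `ψ ∈ L²` with `g ψ ∈ L²`. -/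
def mulDomain {d : ℕ} (g : Space d → ℝ) : Submodule ℂ (L2 d) where
  carrier := {ψ | MemLp (fun x => (g x : ℂ) * ψ x) 2 (volume : Measure (Space d))}
  zero_mem' := MemLp.ae_eq (mul_zero_ae g) MemLp.zero
  add_mem' := fun {ψ φ} hψ hφ => MemLp.ae_eq (mul_add_ae g ψ φ) (MemLp.add hψ hφ)
  smul_mem' := fun c ψ hψ => MemLp.ae_eq (mul_smul_ae g c ψ) (MemLp.const_smul hψ c)

theorem mem_mulDomain {d : ℕ} {g : Space d → ℝ} {ψ : L2 d} :
    ψ ∈ mulDomain g ↔ MemLp (fun x => (g x : ℂ) * ψ x) 2 (volume : Measure (Space d)) :=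
  Iff.rfl

/-- The product `g ψ` as an element of `L²(ℝᵈ)`, for `ψ` in the maximal domain. -/
def mulFun {d : ℕ} (g : Space d → ℝ) (ψ : mulDomain g) : L2 d :=
  MemLp.toLp (fun x => (g x : ℂ) * (ψ : L2 d) x) (mem_mulDomain.mp ψ.2)

theorem mulFun_ae {d : ℕ} (g : Space d → ℝ) (ψ : mulDomain g) :
    mulFun g ψ =ᵐ[volume] fun x => (g x : ℂ) * (ψ : L2 d) x :=
  MemLp.coeFn_toLp _

/-- The maximal operator of multiplication by the function `g` in `L²(ℝᵈ)`: its domain consists of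
all `ψ ∈ L²` with `g ψ ∈ L²`, and it maps `ψ` to `g ψ`. -/
def mulOp {d : ℕ} (g : Space d → ℝ) : L2 d →ₗ.[ℂ] L2 d where
  domain := mulDomain g
  toFun :=
    { toFun := mulFun g
      map_add' := by
        intro ψ φ
        apply Lp.ext
        refine (mulFun_ae g (ψ + φ)).trans (EventuallyEq.trans ?_ (Lp.coeFn_add _ _).symm)
        exact (mul_add_ae g ψ φ).symm.trans ((mulFun_ae g ψ).symm.add (mulFun_ae g φ).symm)
      map_smul' := by
        intro c ψ
        apply Lp.ext
        refine (mulFun_ae g (c • ψ)).trans (EventuallyEq.trans ?_ (Lp.coeFn_smul _ _).symm)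
        exact (mul_smul_ae g c ψ).symm.trans ((mulFun_ae g ψ).symm.const_smul c) }

/-- The unitary Fourier transform on `L²(ℝᵈ)`, with kernel `exp (-2πi x·ξ)`. -/
abbrev fourierL2 (d : ℕ) : L2 d ≃ₗᵢ[ℂ] L2 d := Lp.fourierTransformₗᵢ (Space d) ℂ

/-- The operator `m(p)`, `p = -i∇`, defined by conjugating multiplication with the Fourier
transform. Because the kernel of the Fourier transform is `exp (-2πi x·ξ)`, the operator `p`
corresponds to multiplication by `2πξ`. The domain consists of all `ψ ∈ L²` such that
`m(2πξ) (𝓕ψ)(ξ)` is in `L²`. -/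
def momentumOp {d : ℕ} (m : Space d → ℝ) : L2 d →ₗ.[ℂ] L2 d where
  domain := (mulOp fun ξ => m ((2 * Real.pi) • ξ)).domain.comap
    (fourierL2 d).toLinearEquiv.toLinearMap
  toFun := (fourierL2 d).symm.toLinearEquiv.toLinearMap ∘ₗ
    (mulOp fun ξ => m ((2 * Real.pi) • ξ)).toFun ∘ₗ
      ((fourierL2 d).toLinearEquiv.toLinearMap.restrict fun _ h => h)

/-- The kinetic term `H₀ = Ψ(p²/2)`. -/
def kineticOp (d : ℕ) (Ψ : ℝ → ℝ) : L2 d →ₗ.[ℂ] L2 d :=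
  momentumOp fun p => Ψ (‖p‖ ^ 2 / 2)

/-- The Schrödinger operator `H = Ψ(p²/2) + V`, with domain `Dom(H₀) ∩ Dom(V)`, which is `Dom(H₀)`
when `V` is bounded and measurable. -/
def schrodingerOp {d : ℕ} (Ψ : ℝ → ℝ) (V : Space d → ℝ) : L2 d →ₗ.[ℂ] L2 d :=
  kineticOp d Ψ + mulOp V

/-- `z` is an eigenvalue of the (possibly unbounded) operator `T`. -/
def IsEigenvalue {d : ℕ} (T : L2 d →ₗ.[ℂ] L2 d) (z : ℂ) : Prop :=
  ∃ ψ : T.domain, (ψ : L2 d) ≠ 0 ∧ T ψ = z • (ψ : L2 d)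

end NonlocalSchrodinger

end

noncomputable section

namespace NonlocalSchrodinger

open scoped FourierTransform

variable {d : ℕ}

/-! This is a virial argument. Formally, commuting `H` with the generator of dilations gives `⟨ψ,
p²Ψ'(p²/2)ψ⟩ = ⟨ψ, (x·∇V)ψ⟩` for an eigenvector `ψ`. The lower bound on `Ψ'` and the sign condition
on `V` then yield `μ⟨H₀⟩ ≤ ⟨x·∇V⟩ ≤ -μ⟨V⟩`, so `μE‖ψ‖² = μ⟨H₀ + V⟩ ≤ 0`, which is impossible for `E
> 0`.

Since `ψ` need not lie in the domain of the generator, the commutator is replaced by a finite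
difference. Pairing `Hψ = Eψ` with the dilated vector `Dψ`, and pairing the dilated equation with
`ψ`, both give `E⟨Dψ, ψ⟩`; subtracting removes `E` (`integral_sub_dilation_of_eigen`). Dividing by
`t - 1` and letting `t ↓ 1` gives `virial_identity`. The upper bound on `uΨ'` and the decay of `∇V`
dominate the difference quotients, using only `ψ ∈ Dom(H₀)`, and `Dψ → ψ` in `L²`. -/

/-! ### Dilations on `L²`, their Fourier transform and strong continuity. -/

theorem quasiMeasurePreserving_smul {t : ℝ} (ht : t ≠ 0) :
    Measure.QuasiMeasurePreserving (fun x : Space d => t • x) volume volume := by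
  refine ⟨by fun_prop, ?_⟩
  rw [Measure.map_addHaar_smul volume ht]
  exact Measure.smul_absolutelyContinuous

theorem memLp_comp_smul {t : ℝ} (ht : t ≠ 0) {f : Space d → ℂ}
    (hf : MemLp f 2 (volume : Measure (Space d))) :
    MemLp (fun x => f (t • x)) 2 (volume : Measure (Space d)) := by
  have h : MemLp f 2 (Measure.map (fun x : Space d => t • x) volume) := by
    rw [Measure.map_addHaar_smul volume ht]
    exact hf.smul_measure ENNReal.ofReal_ne_top
  exact h.comp_of_map (by fun_prop)

/-- The dilation `(D f)(x) = f (t x)` as a function on `L²`. -/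
def dilationFun (t : ℝ) (ht : t ≠ 0) (f : L2 d) : L2 d :=
  (memLp_comp_smul ht (Lp.memLp f)).toLp _

theorem dilationFun_ae {t : ℝ} (ht : t ≠ 0) (f : L2 d) :
    dilationFun t ht f =ᵐ[volume] fun x => f (t • x) :=
  MemLp.coeFn_toLp _

theorem inner_dilationFun {t : ℝ} (ht : t ≠ 0) (f g : L2 d) :
    inner ℂ (dilationFun t ht f) (dilationFun t ht g) = |(t ^ d)⁻¹| • inner ℂ f g := by
  have h := Measure.integral_comp_smul (volume : Measure (Space d))
    (fun x => inner ℂ (f x) (g x)) t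
  rw [finrank_euclideanSpace_fin] at h
  rw [L2.inner_def, L2.inner_def, ← h]
  refine integral_congr_ae ?_
  filter_upwards [dilationFun_ae ht f, dilationFun_ae ht g] with x hf hg
  rw [hf, hg]

theorem norm_dilationFun_sq {t : ℝ} (ht : t ≠ 0) (f : L2 d) :
    ‖dilationFun t ht f‖ ^ 2 = |(t ^ d)⁻¹| * ‖f‖ ^ 2 := by
  have h := inner_dilationFun ht f f
  rw [inner_self_eq_norm_sq_to_K, inner_self_eq_norm_sq_to_K, Complex.real_smul] at h
  exact Complex.ofReal_injective (by push_cast; exact h)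

theorem norm_dilationFun {t : ℝ} (ht : t ≠ 0) (f : L2 d) :
    ‖dilationFun t ht f‖ = √|(t ^ d)⁻¹| * ‖f‖ := by
  rw [← Real.sqrt_sq (norm_nonneg (dilationFun t ht f)), norm_dilationFun_sq,
    Real.sqrt_mul (abs_nonneg _), Real.sqrt_sq (norm_nonneg f)]

/-- The dilation `(D f)(x) = f (t x)` as a bounded operator on `L²`. -/
def dilation (t : ℝ) (ht : t ≠ 0) : L2 d →L[ℂ] L2 d :=
  LinearMap.mkContinuous
    { toFun := dilationFun t ht
      map_add' := by
        intro f g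
        apply Lp.ext
        filter_upwards [dilationFun_ae ht (f + g), dilationFun_ae ht f, dilationFun_ae ht g,
          Lp.coeFn_add (dilationFun t ht f) (dilationFun t ht g),
          (quasiMeasurePreserving_smul ht).ae_eq_comp (Lp.coeFn_add f g)] with x h h1 h2 h3 h4
        simp only [Function.comp_apply, Pi.add_apply] at h3 h4
        rw [h, h3, h1, h2, h4]
      map_smul' := by
        intro c f
        apply Lp.ext
        filter_upwards [dilationFun_ae ht (c • f), dilationFun_ae ht f,
          Lp.coeFn_smul c (dilationFun t ht f),
          (quasiMeasurePreserving_smul ht).ae_eq_comp (Lp.coeFn_smul c f)] with x h h1 h3 h4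
        simp only [Function.comp_apply, Pi.smul_apply] at h3 h4
        rw [RingHom.id_apply, h, h3, h1, h4] }
    (√|(t ^ d)⁻¹|) fun f => (norm_dilationFun ht f).le

theorem dilation_ae {t : ℝ} (ht : t ≠ 0) (f : L2 d) :
    dilation t ht f =ᵐ[volume] fun x => f (t • x) :=
  dilationFun_ae ht f

theorem norm_dilation_sq {t : ℝ} (ht : t ≠ 0) (f : L2 d) :
    ‖dilation t ht f‖ ^ 2 = |(t ^ d)⁻¹| * ‖f‖ ^ 2 :=
  norm_dilationFun_sq ht f

theorem norm_dilation {t : ℝ} (ht : t ≠ 0) (f : L2 d) :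
    ‖dilation t ht f‖ = √|(t ^ d)⁻¹| * ‖f‖ :=
  norm_dilationFun ht f

theorem norm_dilation_le {t : ℝ} (ht : 1 ≤ t) (f : L2 d) :
    ‖dilation t (zero_lt_one.trans_le ht).ne' f‖ ≤ ‖f‖ := by
  rw [norm_dilation]
  refine mul_le_of_le_one_left (norm_nonneg f) (Real.sqrt_le_one.mpr ?_)
  rw [abs_of_pos (by positivity)]
  exact inv_le_one_of_one_le₀ (one_le_pow₀ ht)

theorem fourier_comp_smul (f : Space d → ℂ) {t : ℝ} (ht : t ≠ 0) (ξ : Space d) :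
    𝓕 (fun x => f (t • x)) ξ = |(t ^ d)⁻¹| • 𝓕 f (t⁻¹ • ξ) := by
  rw [Real.fourier_eq, Real.fourier_eq]
  have h := Measure.integral_comp_smul (volume : Measure (Space d))
    (fun v => 𝐞 (-inner ℝ v (t⁻¹ • ξ)) • f v) t
  rw [finrank_euclideanSpace_fin] at h
  rw [← h]
  refine integral_congr_ae (Eventually.of_forall fun x => ?_)
  simp only [real_inner_smul_left, real_inner_smul_right, inv_mul_cancel_left₀ ht]

/-- The dilation of a Schwartz function. -/
def schwartzDilation (t : ℝ) (ht : t ≠ 0) (s : SchwartzMap (Space d) ℂ) :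
    SchwartzMap (Space d) ℂ :=
  SchwartzMap.compCLMOfContinuousLinearEquiv ℂ
    (ContinuousLinearEquiv.smulLeft (Units.mk0 t ht) : Space d ≃L[ℝ] Space d) s

theorem schwartzDilation_apply {t : ℝ} (ht : t ≠ 0) (s : SchwartzMap (Space d) ℂ) (x : Space d) :
    schwartzDilation t ht s x = s (t • x) :=
  rfl

/-- A Schwartz function as an element of `L²`. -/
def schwartzL2 (s : SchwartzMap (Space d) ℂ) : L2 d :=
  s.toLp 2 volume

theorem schwartzL2_ae (s : SchwartzMap (Space d) ℂ) : schwartzL2 s =ᵐ[volume] s :=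
  s.coeFn_toLp 2

theorem denseRange_schwartzL2 : DenseRange (schwartzL2 (d := d)) :=
  SchwartzMap.denseRange_toLpCLM (p := 2) (F := ℂ) (μ := (volume : Measure (Space d)))
    ENNReal.ofNat_ne_top

theorem fourierL2_schwartzL2 (s : SchwartzMap (Space d) ℂ) :
    fourierL2 d (schwartzL2 s) = schwartzL2 (𝓕 s) :=
  SchwartzMap.toLp_fourier_eq s

theorem dilation_schwartzL2 {t : ℝ} (ht : t ≠ 0) (s : SchwartzMap (Space d) ℂ) :
    dilation t ht (schwartzL2 s) = schwartzL2 (schwartzDilation t ht s) := by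
  apply Lp.ext
  filter_upwards [dilation_ae ht (schwartzL2 s), schwartzL2_ae (schwartzDilation t ht s),
    (quasiMeasurePreserving_smul ht).ae_eq_comp (schwartzL2_ae s)] with x h1 h2 h3
  rw [h1, h2, schwartzDilation_apply]
  exact h3

/-- The change of variables in the Fourier integral is available for Schwartz functions; density and
continuity carry it to `L²`. -/
theorem fourierL2_dilation {t : ℝ} (ht : t ≠ 0) (f : L2 d) :
    fourierL2 d (dilation t ht f) =
      ((|(t ^ d)⁻¹| : ℝ) : ℂ) • dilation t⁻¹ (inv_ne_zero ht) (fourierL2 d f) := by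
  refine DenseRange.induction_on
    (p := fun f => fourierL2 d (dilation t ht f) =
      ((|(t ^ d)⁻¹| : ℝ) : ℂ) • dilation t⁻¹ (inv_ne_zero ht) (fourierL2 d f))
    denseRange_schwartzL2 f
    (isClosed_eq (by fun_prop) (by fun_prop)) fun s => ?_
  rw [dilation_schwartzL2, fourierL2_schwartzL2, fourierL2_schwartzL2, dilation_schwartzL2]
  apply Lp.ext
  filter_upwards [schwartzL2_ae (𝓕 (schwartzDilation t ht s)),
    schwartzL2_ae (schwartzDilation t⁻¹ (inv_ne_zero ht) (𝓕 s)),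
    Lp.coeFn_smul ((|(t ^ d)⁻¹| : ℝ) : ℂ)
      (schwartzL2 (schwartzDilation t⁻¹ (inv_ne_zero ht) (𝓕 s)))]
    with x h1 h2 h3
  rw [h1, h3, Pi.smul_apply, h2, schwartzDilation_apply, SchwartzMap.fourier_coe,
    SchwartzMap.fourier_coe, Complex.coe_smul]
  exact fourier_comp_smul s ht x

theorem tendsto_inner_dilation_schwartzL2 (s : SchwartzMap (Space d) ℂ) {t : ℕ → ℝ}
    (ht : ∀ n, t n ≠ 0) (hlim : Tendsto t atTop (𝓝 1)) :
    Tendsto (fun n => inner ℂ (dilation (t n) (ht n) (schwartzL2 s)) (schwartzL2 s)) atTop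
      (𝓝 (inner ℂ (schwartzL2 s) (schwartzL2 s))) := by
  have key (n : ℕ) : inner ℂ (dilation (t n) (ht n) (schwartzL2 s)) (schwartzL2 s) =
      ∫ x, inner ℂ (s (t n • x)) (s x) := by
    rw [dilation_schwartzL2, L2.inner_def]
    refine integral_congr_ae ?_
    filter_upwards [schwartzL2_ae s, schwartzL2_ae (schwartzDilation _ (ht n) s)] with x h1 h2
    rw [h1, h2, schwartzDilation_apply]
  have key' : inner ℂ (schwartzL2 s) (schwartzL2 s) = ∫ x, inner ℂ (s x) (s x) := by
    rw [L2.inner_def]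
    refine integral_congr_ae ?_
    filter_upwards [schwartzL2_ae s] with x h1
    rw [h1]
  simp_rw [key, key']
  refine tendsto_integral_of_dominated_convergence
    (fun x => ‖s.toBoundedContinuousFunction‖ * ‖s x‖) (fun n => ?_) ?_ (fun n => ?_) ?_
  · have := s.continuous
    exact (by fun_prop : Continuous fun x => inner ℂ (s (t n • x)) (s x)).aestronglyMeasurable
  · exact s.integrable.norm.const_mul _
  · refine Eventually.of_forall fun x => (norm_inner_le_norm _ _).trans ?_
    gcongr
    exact s.toBoundedContinuousFunction.norm_coe_le_norm _
  · refine Eventually.of_forall fun x => ?_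
    have h : Tendsto (fun n => s (t n • x)) atTop (𝓝 (s x)) := by
      have := (s.continuous.tendsto ((1 : ℝ) • x)).comp (hlim.smul_const x)
      rwa [one_smul] at this
    exact h.inner tendsto_const_nhds

theorem tendsto_dilation_schwartzL2 (s : SchwartzMap (Space d) ℂ) {t : ℕ → ℝ}
    (ht : ∀ n, t n ≠ 0) (hlim : Tendsto t atTop (𝓝 1)) :
    Tendsto (fun n => dilation (t n) (ht n) (schwartzL2 s)) atTop (𝓝 (schwartzL2 s)) := by
  rw [tendsto_iff_norm_sub_tendsto_zero]
  have hN : Tendsto (fun n => |(t n ^ d)⁻¹|) atTop (𝓝 1) := by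
    have := ((hlim.pow d).inv₀ (by simp)).abs
    simpa using this
  -- Expanding the square leaves only the cross term to control, as the norm of a dilate is
  -- explicit.
  have hsq : Tendsto (fun n => ‖dilation (t n) (ht n) (schwartzL2 s) - schwartzL2 s‖ ^ 2)
      atTop (𝓝 0) := by
    have h1 := (Complex.continuous_re.tendsto _).comp (tendsto_inner_dilation_schwartzL2 s ht hlim)
    have h2 := ((hN.mul_const (‖schwartzL2 s‖ ^ 2)).sub (h1.const_mul 2)).add_const
      (‖schwartzL2 s‖ ^ 2)
    convert h2 using 2 with n
    · rw [@norm_sub_sq ℂ, norm_dilation_sq]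
      rfl
    · rw [inner_self_eq_norm_sq_to_K]
      change (0 : ℝ) = _ - 2 * (((‖schwartzL2 s‖ : ℂ)) ^ 2).re + _
      rw [← Complex.ofReal_pow, Complex.ofReal_re]
      ring
  have := hsq.sqrt
  simpa using this

/-- An `ε/3` argument from Schwartz functions: for `t > 1` the dilations are contractions, hence
uniformly bounded. -/
theorem tendsto_dilation (f : L2 d) {t : ℕ → ℝ} (ht : ∀ n, 1 < t n)
    (hlim : Tendsto t atTop (𝓝 1)) :
    Tendsto (fun n => dilation (t n) (zero_lt_one.trans (ht n)).ne' f) atTop (𝓝 f) := by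
  rw [Metric.tendsto_atTop]
  intro ε hε
  obtain ⟨s, hs⟩ := denseRange_schwartzL2.exists_dist_lt f (by positivity : 0 < ε / 3)
  obtain ⟨N, hN⟩ := Metric.tendsto_atTop.mp
    (tendsto_dilation_schwartzL2 s (fun n => (zero_lt_one.trans (ht n)).ne') hlim) (ε / 3)
    (by positivity)
  refine ⟨N, fun n hn => ?_⟩
  have h1 : dist (dilation (t n) (zero_lt_one.trans (ht n)).ne' f)
      (dilation (t n) (zero_lt_one.trans (ht n)).ne' (schwartzL2 s)) < ε / 3 := by
    rw [dist_eq_norm, ← map_sub]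
    exact (norm_dilation_le (ht n).le _).trans_lt (by rwa [← dist_eq_norm])
  have h2 := dist_triangle4 (dilation (t n) (zero_lt_one.trans (ht n)).ne' f)
    (dilation (t n) (zero_lt_one.trans (ht n)).ne' (schwartzL2 s)) (schwartzL2 s) f
  have h3 := hN n hn
  rw [dist_comm] at hs
  linarith

/-! ### Quadratic forms of multiplication operators and their limits. -/

theorem inner_eq_integral_mul {m : Space d → ℝ} {φ f w : L2 d}
    (hw : w =ᵐ[volume] fun x => (m x : ℂ) * f x) :
    inner ℂ φ w = ∫ x, (m x : ℂ) * inner ℂ (φ x) (f x) := by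
  rw [L2.inner_def]
  refine integral_congr_ae ?_
  filter_upwards [hw] with x h
  rw [h, ← smul_eq_mul, inner_smul_right]

theorem integrable_mul_inner {m : Space d → ℝ} {φ f w : L2 d}
    (hw : w =ᵐ[volume] fun x => (m x : ℂ) * f x) :
    Integrable (fun x => (m x : ℂ) * inner ℂ (φ x) (f x)) := by
  refine (L2.integrable_inner (𝕜 := ℂ) φ w).congr ?_
  filter_upwards [hw] with x h
  rw [h, ← smul_eq_mul, inner_smul_right]

theorem inner_self_eq_ofReal_norm_sq (z : ℂ) : inner ℂ z z = ((‖z‖ ^ 2 : ℝ) : ℂ) := by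
  rw [inner_self_eq_norm_sq_to_K]
  push_cast
  rfl

theorem integral_mul_inner_self (m : Space d → ℝ) (f : L2 d) :
    ∫ x, (m x : ℂ) * inner ℂ (f x) (f x) = ((∫ x, m x * ‖f x‖ ^ 2 : ℝ) : ℂ) := by
  rw [← integral_complex_ofReal]
  simp_rw [inner_self_eq_ofReal_norm_sq, Complex.ofReal_mul]

theorem integrable_mul_norm_sq {m : Space d → ℝ} {f w : L2 d}
    (hw : w =ᵐ[volume] fun x => (m x : ℂ) * f x) :
    Integrable (fun x => m x * ‖f x‖ ^ 2) := by
  refine (integrable_mul_inner (φ := f) hw).re.congr (Eventually.of_forall fun x => ?_)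
  simp only [inner_self_eq_ofReal_norm_sq, ← Complex.ofReal_mul]
  exact Complex.ofReal_re _

/-- The bound is on `m f` rather than on `m`, because the kinetic multipliers may be unbounded. -/
theorem memLp_mul_of_dominated {m : Space d → ℝ} {f : L2 d} {K : Space d → ℝ}
    (hm : Measurable m) (hK : MemLp K 2 (volume : Measure (Space d)))
    (h : ∀ x, |m x| * ‖f x‖ ≤ K x) :
    MemLp (fun x => (m x : ℂ) * f x) 2 (volume : Measure (Space d)) := by
  refine hK.mono' ?_ (Eventually.of_forall fun x => ?_)
  · exact (Complex.measurable_ofReal.comp hm).aestronglyMeasurable.mul (Lp.aestronglyMeasurable f)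
  · rw [norm_mul, Complex.norm_real]
    exact h x

theorem tendsto_integral_mul_inner_self {m : ℕ → Space d → ℝ} {m₀ : Space d → ℝ} {f : L2 d}
    {K : Space d → ℝ} (hm : ∀ n, Measurable (m n))
    (hK : MemLp K 2 (volume : Measure (Space d))) (hmK : ∀ n x, |m n x| * ‖f x‖ ≤ K x)
    (hlim : ∀ x, Tendsto (fun n => m n x) atTop (𝓝 (m₀ x))) :
    Tendsto (fun n => ∫ x, (m n x : ℂ) * inner ℂ (f x) (f x)) atTop
      (𝓝 (∫ x, (m₀ x : ℂ) * inner ℂ (f x) (f x))) := by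
  have hf := Lp.memLp f
  refine tendsto_integral_of_dominated_convergence (fun x => K x * ‖f x‖) (fun n => ?_) ?_
    (fun n => Eventually.of_forall fun x => ?_) (Eventually.of_forall fun x => ?_)
  · exact (integrable_mul_inner (φ := f)
      (memLp_mul_of_dominated (hm n) hK (hmK n)).coeFn_toLp).aestronglyMeasurable
  · exact hK.integrable_mul hf.norm
  · rw [norm_mul, Complex.norm_real, Real.norm_eq_abs]
    calc |m n x| * ‖inner ℂ (f x) (f x)‖ ≤ |m n x| * (‖f x‖ * ‖f x‖) := by
          gcongr
          exact norm_inner_le_norm _ _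
      _ = |m n x| * ‖f x‖ * ‖f x‖ := by ring
      _ ≤ K x * ‖f x‖ := by
          gcongr
          exact hmK n x
  · exact ((Complex.continuous_ofReal.tendsto _).comp (hlim x)).mul_const _

/-- As `φ n` converges only in `L²`, dominated convergence does not apply directly. The part with `φ
n - f` vanishes by Cauchy–Schwarz, since the `m n f` are bounded in `L²` by `K`; the rest has `f` in
both slots. -/
theorem tendsto_integral_mul_inner {m : ℕ → Space d → ℝ} {m₀ : Space d → ℝ} {φ : ℕ → L2 d}
    {f : L2 d} {K : Space d → ℝ} (hm : ∀ n, Measurable (m n))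
    (hK : MemLp K 2 (volume : Measure (Space d))) (hmK : ∀ n x, |m n x| * ‖f x‖ ≤ K x)
    (hlim : ∀ x, Tendsto (fun n => m n x) atTop (𝓝 (m₀ x))) (hφ : Tendsto φ atTop (𝓝 f)) :
    Tendsto (fun n => ∫ x, (m n x : ℂ) * inner ℂ (φ n x) (f x)) atTop
      (𝓝 ((∫ x, m₀ x * ‖f x‖ ^ 2 : ℝ) : ℂ)) := by
  have hmem n := memLp_mul_of_dominated (hm n) hK (hmK n)
  set w : ℕ → L2 d := fun n => (hmem n).toLp _
  have hw n : w n =ᵐ[volume] fun x => (m n x : ℂ) * f x := (hmem n).coeFn_toLp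
  have hbound n : ‖w n‖ ≤ ‖hK.toLp K‖ := by
    refine Lp.norm_le_norm_of_ae_le ?_
    filter_upwards [hw n, hK.coeFn_toLp] with x h1 h2
    rw [h1, h2, norm_mul, Complex.norm_real]
    exact (hmK n x).trans (le_abs_self _)
  have h1 : Tendsto (fun n => inner ℂ (φ n - f) (w n)) atTop (𝓝 0) := by
    refine squeeze_zero_norm (fun n => (norm_inner_le_norm _ _).trans
      (mul_le_mul_of_nonneg_left (hbound n) (norm_nonneg _))) ?_
    simpa using (tendsto_iff_norm_sub_tendsto_zero.mp hφ).mul_const ‖hK.toLp K‖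
  have h2 := h1.add (tendsto_integral_mul_inner_self hm hK hmK hlim)
  rw [zero_add, integral_mul_inner_self] at h2
  refine h2.congr fun n => ?_
  rw [inner_sub_left, inner_eq_integral_mul (hw n), inner_eq_integral_mul (hw n), sub_add_cancel]

/-! ### The eigenvalue equation paired with `ψ` and with its dilate. -/

theorem integral_mul_norm_sq_of_eigen {g V : Space d → ℝ} {ψ G W : L2 d} {E : ℝ}
    (hG : G =ᵐ[volume] fun ξ => (g ξ : ℂ) * fourierL2 d ψ ξ)
    (hW : W =ᵐ[volume] fun x => (V x : ℂ) * ψ x)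
    (heq : (fourierL2 d).symm G + W = (E : ℂ) • ψ) :
    (∫ ξ, g ξ * ‖fourierL2 d ψ ξ‖ ^ 2) + ∫ x, V x * ‖ψ x‖ ^ 2 = E * ‖ψ‖ ^ 2 := by
  have h := congrArg (inner ℂ ψ) heq
  rw [inner_add_right, inner_smul_right, ← (fourierL2 d).inner_map_map ψ,
    LinearIsometryEquiv.apply_symm_apply, inner_eq_integral_mul hG, inner_eq_integral_mul hW,
    integral_mul_inner_self, integral_mul_inner_self, inner_self_eq_norm_sq_to_K] at h
  exact Complex.ofReal_injective (by push_cast; exact h)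

/-- Pairing an eigenvector with its own dilation: the eigenvalue drops out, and what is left are
the differences of the symbols with their dilated versions. -/
theorem integral_sub_dilation_of_eigen {g V : Space d → ℝ} {ψ G W : L2 d} {E : ℝ}
    (hG : G =ᵐ[volume] fun ξ => (g ξ : ℂ) * fourierL2 d ψ ξ)
    (hW : W =ᵐ[volume] fun x => (V x : ℂ) * ψ x)
    (heq : (fourierL2 d).symm G + W = (E : ℂ) • ψ) {t : ℝ} (ht : t ≠ 0) :
    (∫ ξ, ((g ξ - g (t⁻¹ • ξ) : ℝ) : ℂ) *
        inner ℂ (fourierL2 d (dilation t ht ψ) ξ) (fourierL2 d ψ ξ)) +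
      ∫ x, ((V x - V (t • x) : ℝ) : ℂ) * inner ℂ (dilation t ht ψ x) (ψ x) = 0 := by
  set φ := dilation t ht ψ with hφ
  set N : ℂ := ((|(t ^ d)⁻¹| : ℝ) : ℂ) with hN
  have hφF := fourierL2_dilation ht ψ
  rw [← hφ, ← hN] at hφF
  have h1 : inner ℂ (fourierL2 d φ) G + inner ℂ φ W = E * inner ℂ φ ψ := by
    have h := congrArg (inner ℂ φ) heq
    rwa [inner_add_right, inner_smul_right, ← (fourierL2 d).inner_map_map φ,
      LinearIsometryEquiv.apply_symm_apply] at h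
  have h2 : inner ℂ (N • dilation t⁻¹ (inv_ne_zero ht) G) (fourierL2 d ψ) +
      inner ℂ (dilation t ht W) ψ = E * inner ℂ φ ψ := by
    have h := congrArg (fun u => inner ℂ (dilation t ht u) ψ) heq
    simp only [map_add, map_smul] at h
    rwa [inner_add_left, inner_smul_left, Complex.conj_ofReal, ← (fourierL2 d).inner_map_map,
      fourierL2_dilation, LinearIsometryEquiv.apply_symm_apply] at h
  -- The Jacobian `N` is absorbed: `N` times the dilate of `𝓕ψ` by `t⁻¹` is `𝓕φ`.
  have hA : (fun ξ => inner ℂ ((N • dilation t⁻¹ (inv_ne_zero ht) G : L2 d) ξ) (fourierL2 d ψ ξ))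
      =ᵐ[volume] fun ξ => (g (t⁻¹ • ξ) : ℂ) * inner ℂ (fourierL2 d φ ξ) (fourierL2 d ψ ξ) := by
    rw [hφF]
    filter_upwards [Lp.coeFn_smul N (dilation t⁻¹ (inv_ne_zero ht) G),
      Lp.coeFn_smul N (dilation t⁻¹ (inv_ne_zero ht) (fourierL2 d ψ)),
      dilation_ae (inv_ne_zero ht) G, dilation_ae (inv_ne_zero ht) (fourierL2 d ψ),
      (quasiMeasurePreserving_smul (inv_ne_zero ht)).ae_eq_comp hG] with ξ h3 h4 h5 h6 h7
    simp only [Function.comp_apply] at h7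
    rw [h3, h4, Pi.smul_apply, Pi.smul_apply, h5, h6, h7]
    simp only [smul_eq_mul, RCLike.inner_apply, map_mul, Complex.conj_ofReal]
    ring
  have hB : (fun x => inner ℂ (dilation t ht W x) (ψ x))
      =ᵐ[volume] fun x => (V (t • x) : ℂ) * inner ℂ (φ x) (ψ x) := by
    filter_upwards [dilation_ae ht W, dilation_ae ht ψ,
      (quasiMeasurePreserving_smul ht).ae_eq_comp hW] with x h3 h4 h5
    simp only [Function.comp_apply] at h5
    rw [hφ, h3, h4, h5]
    simp only [RCLike.inner_apply, map_mul, Complex.conj_ofReal]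
    ring
  have hAi := (L2.integrable_inner (𝕜 := ℂ) (N • dilation t⁻¹ (inv_ne_zero ht) G)
    (fourierL2 d ψ)).congr hA
  have hBi := (L2.integrable_inner (𝕜 := ℂ) (dilation t ht W) ψ).congr hB
  rw [inner_eq_integral_mul hG, inner_eq_integral_mul hW] at h1
  rw [L2.inner_def, L2.inner_def, integral_congr_ae hA, integral_congr_ae hB] at h2
  simp_rw [Complex.ofReal_sub, sub_mul]
  rw [integral_sub (integrable_mul_inner hG) hAi, integral_sub (integrable_mul_inner hW) hBi]
  linear_combination h1 - h2

/-! ### Difference quotients of the symbol and of the potential. -/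

theorem tendsto_sub_div_of_hasDerivAt {h : ℝ → ℝ} {h' : ℝ} (hh : HasDerivAt h h' 1) {t : ℕ → ℝ}
    (ht : ∀ n, 1 < t n) (hlim : Tendsto t atTop (𝓝 1)) :
    Tendsto (fun n => (h 1 - h (t n)) / (t n - 1)) atTop (𝓝 (-h')) := by
  have h1 : Tendsto t atTop (𝓝[≠] 1) :=
    tendsto_nhdsWithin_iff.mpr ⟨hlim, Eventually.of_forall fun n => (ht n).ne'⟩
  refine (((hasDerivAt_iff_tendsto_slope.mp hh).comp h1).neg).congr fun n => ?_
  simp only [Function.comp_apply, slope_def_field]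
  ring

section Symbol

variable {Ψ : ℝ → ℝ}

theorem hasDerivAt_of_contDiffOn (hΨ_C1 : ContDiffOn ℝ 1 Ψ (Ioi 0)) {u : ℝ} (hu : 0 < u) :
    HasDerivAt Ψ (deriv Ψ u) u :=
  ((hΨ_C1.differentiableOn one_ne_zero).differentiableAt (Ioi_mem_nhds hu)).hasDerivAt

theorem monotoneOn_of_contDiffOn (hΨ_C1 : ContDiffOn ℝ 1 Ψ (Ioi 0))
    (hΨ_deriv_nonneg : ∀ u, 0 < u → 0 ≤ deriv Ψ u) : MonotoneOn Ψ (Ioi 0) := by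
  refine monotoneOn_of_deriv_nonneg (convex_Ioi 0) hΨ_C1.continuousOn ?_ ?_
  · rw [interior_Ioi]
    exact hΨ_C1.differentiableOn one_ne_zero
  · rw [interior_Ioi]
    exact hΨ_deriv_nonneg

theorem continuousOn_Ici_of_contDiffOn (hΨ_C1 : ContDiffOn ℝ 1 Ψ (Ioi 0))
    (hΨ_lim : Tendsto Ψ (𝓝[>] 0) (𝓝 0)) (hΨ_zero : Ψ 0 = 0) : ContinuousOn Ψ (Ici 0) := by
  intro u hu
  rcases (mem_Ici.mp hu).eq_or_lt with rfl | hu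
  · rw [← Ioi_insert, continuousWithinAt_insert_self, ContinuousWithinAt, hΨ_zero]
    exact hΨ_lim
  · exact (hasDerivAt_of_contDiffOn hΨ_C1 hu).continuousAt.continuousWithinAt

theorem hasDerivAt_comp_inv_sq (hΨ_C1 : ContDiffOn ℝ 1 Ψ (Ioi 0)) {u s : ℝ} (hu : 0 < u)
    (hs : 0 < s) :
    HasDerivAt (fun s => Ψ (u * s⁻¹ ^ 2))
      (-(2 * s⁻¹ * (u * s⁻¹ ^ 2 * deriv Ψ (u * s⁻¹ ^ 2)))) s := by
  have h1 : HasDerivAt (fun s : ℝ => u * s⁻¹ ^ 2) (u * (2 * s⁻¹ * -(s ^ 2)⁻¹)) s := by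
    simpa using ((hasDerivAt_inv hs.ne').pow 2).const_mul u
  convert! (hasDerivAt_of_contDiffOn hΨ_C1 (by positivity : 0 < u * s⁻¹ ^ 2)).comp s h1 using 1
  rw [← inv_pow]
  ring

/-- Mean value inequality in the scaling parameter. For `s ≥ 1` the argument `u s⁻²` is at most `u`,
so monotonicity of `Ψ` makes the bound uniform in `s`; this is why the dilations have `t > 1`. -/
theorem abs_sub_comp_inv_sq_le {c₂ d₂ : ℝ} (hΨ_C1 : ContDiffOn ℝ 1 Ψ (Ioi 0))
    (hΨ_nonneg : ∀ u, 0 ≤ u → 0 ≤ Ψ u) (hΨ_deriv_nonneg : ∀ u, 0 < u → 0 ≤ deriv Ψ u)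
    (hc₂ : 0 ≤ c₂) (hd₂ : 0 ≤ d₂) (hΨ_upper : ∀ u, 0 < u → u * deriv Ψ u ≤ c₂ * Ψ u + d₂)
    {u t : ℝ} (hu : 0 ≤ u) (ht : 1 ≤ t) :
    |Ψ u - Ψ (u * t⁻¹ ^ 2)| ≤ 2 * (c₂ * Ψ u + d₂) * (t - 1) := by
  rcases hu.eq_or_lt with rfl | hu
  · have := hΨ_nonneg 0 le_rfl
    have := sub_nonneg.mpr ht
    simp only [zero_mul, sub_self, abs_zero]
    positivity
  · have h := (convex_Icc 1 t).norm_image_sub_le_of_norm_hasDerivWithin_le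
      (f := fun s => Ψ (u * s⁻¹ ^ 2)) (C := 2 * (c₂ * Ψ u + d₂)) (fun s hs =>
        (hasDerivAt_comp_inv_sq hΨ_C1 hu (zero_lt_one.trans_le hs.1)).hasDerivWithinAt)
      (fun s hs => ?_) (right_mem_Icc.mpr ht) (left_mem_Icc.mpr ht)
    · simpa [abs_sub_comm (1 : ℝ) t, abs_of_nonneg (sub_nonneg.mpr ht)] using h
    · have hs0 : 0 < s := zero_lt_one.trans_le hs.1
      have hv : 0 < u * s⁻¹ ^ 2 := by positivity
      have hs1 : s⁻¹ ≤ 1 := inv_le_one_of_one_le₀ hs.1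
      have hmono : Ψ (u * s⁻¹ ^ 2) ≤ Ψ u :=
        monotoneOn_of_contDiffOn hΨ_C1 hΨ_deriv_nonneg hv hu
          (mul_le_of_le_one_right hu.le (pow_le_one₀ (by positivity) hs1))
      have h0 : 0 ≤ u * s⁻¹ ^ 2 * deriv Ψ (u * s⁻¹ ^ 2) :=
        mul_nonneg hv.le (hΨ_deriv_nonneg _ hv)
      rw [Real.norm_eq_abs, abs_neg, abs_of_nonneg (by positivity)]
      calc 2 * s⁻¹ * (u * s⁻¹ ^ 2 * deriv Ψ (u * s⁻¹ ^ 2))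
          ≤ 2 * 1 * (u * s⁻¹ ^ 2 * deriv Ψ (u * s⁻¹ ^ 2)) := by gcongr
        _ ≤ 2 * 1 * (c₂ * Ψ (u * s⁻¹ ^ 2) + d₂) := by
            gcongr
            exact hΨ_upper _ hv
        _ ≤ 2 * (c₂ * Ψ u + d₂) := by
            rw [mul_one]
            gcongr

theorem tendsto_sub_comp_inv_sq_div (hΨ_C1 : ContDiffOn ℝ 1 Ψ (Ioi 0)) {u : ℝ} (hu : 0 ≤ u)
    {t : ℕ → ℝ} (ht : ∀ n, 1 < t n) (hlim : Tendsto t atTop (𝓝 1)) :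
    Tendsto (fun n => (Ψ u - Ψ (u * (t n)⁻¹ ^ 2)) / (t n - 1)) atTop
      (𝓝 (2 * u * deriv Ψ u)) := by
  rcases hu.eq_or_lt with rfl | hu
  · simp
  · have h := tendsto_sub_div_of_hasDerivAt (hasDerivAt_comp_inv_sq hΨ_C1 hu one_pos) ht hlim
    simpa [mul_assoc] using h

/-- The symbol of the kinetic term, in the variable of the Fourier transform. -/
def kineticSymbol (d : ℕ) (Ψ : ℝ → ℝ) (ξ : Space d) : ℝ :=
  Ψ (‖(2 * Real.pi) • ξ‖ ^ 2 / 2)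

theorem kineticSymbol_smul (r : ℝ) (ξ : Space d) :
    kineticSymbol d Ψ (r • ξ) = Ψ (‖(2 * Real.pi) • ξ‖ ^ 2 / 2 * r ^ 2) := by
  rw [kineticSymbol, smul_comm, norm_smul r, mul_pow, Real.norm_eq_abs, sq_abs]
  ring_nf

theorem continuous_kineticSymbol (hΨ : ContinuousOn Ψ (Ici 0)) :
    Continuous (kineticSymbol d Ψ) :=
  hΨ.comp_continuous (by fun_prop) fun ξ => by rw [mem_Ici]; positivity

end Symbol

section Potential

variable {V : Space d → ℝ}

theorem hasDerivAt_comp_smul (hV : ContDiff ℝ 1 V) (x : Space d) (s : ℝ) :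
    HasDerivAt (fun s : ℝ => V (s • x)) (inner ℝ x (gradient V (s • x))) s := by
  have h1 : HasDerivAt (fun s : ℝ => s • x) x s := by
    simpa using (hasDerivAt_id s).smul_const x
  have h2 := ((hV.differentiable one_ne_zero) (s • x)).hasGradientAt.hasFDerivAt
  convert! h2.comp_hasDerivAt s h1 using 1
  rw [InnerProductSpace.toDual_apply_apply, real_inner_comm]

theorem one_le_bracket (x : Space d) : 1 ≤ bracket x :=
  Real.one_le_sqrt.mpr (le_add_of_nonneg_right (by positivity))

theorem norm_le_bracket (x : Space d) : ‖x‖ ≤ bracket x :=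
  Real.le_sqrt_of_sq_le (by linarith)

theorem norm_mul_norm_gradient_le {c γ : ℝ} (hc : 0 ≤ c) (hγ : 0 ≤ γ)
    (hV_grad_decay : ∀ x, ‖gradient V x‖ ≤ c * bracket x ^ (-1 - γ)) (x : Space d) :
    ‖x‖ * ‖gradient V x‖ ≤ c := by
  have hb : 0 < bracket x := zero_lt_one.trans_le (one_le_bracket x)
  calc ‖x‖ * ‖gradient V x‖ ≤ bracket x * (c * bracket x ^ (-1 - γ)) :=
        mul_le_mul (norm_le_bracket x) (hV_grad_decay x) (norm_nonneg _) hb.le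
    _ = c * bracket x ^ (-γ) := by
        rw [show -γ = 1 + (-1 - γ) by ring, Real.rpow_add hb 1, Real.rpow_one]
        ring
    _ ≤ c * 1 := by
        gcongr
        exact Real.rpow_le_one_of_one_le_of_nonpos (one_le_bracket x) (by linarith)
    _ = c := mul_one c

theorem abs_sub_comp_smul_le {c : ℝ} (hV : ContDiff ℝ 1 V)
    (hgrad : ∀ x, ‖x‖ * ‖gradient V x‖ ≤ c) (x : Space d) {t : ℝ} (ht : 1 ≤ t) :
    |V x - V (t • x)| ≤ c * (t - 1) := by
  have h := (convex_Icc 1 t).norm_image_sub_le_of_norm_hasDerivWithin_le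
    (f := fun s : ℝ => V (s • x)) (C := c)
    (fun s _ => (hasDerivAt_comp_smul hV x s).hasDerivWithinAt)
    (fun s hs => ?_) (right_mem_Icc.mpr ht) (left_mem_Icc.mpr ht)
  · simpa [abs_sub_comm (1 : ℝ) t, abs_of_nonneg (sub_nonneg.mpr ht)] using h
  · refine (norm_inner_le_norm _ _).trans (le_trans ?_ (hgrad (s • x)))
    -- Here `s ≥ 1` gives `‖x‖ ≤ ‖s • x‖`, so the gradient bound applies at the point `s • x`.
    gcongr
    rw [norm_smul]
    exact le_mul_of_one_le_left (norm_nonneg x) (hs.1.trans (le_abs_self s))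

theorem tendsto_sub_comp_smul_div (hV : ContDiff ℝ 1 V) (x : Space d) {t : ℕ → ℝ}
    (ht : ∀ n, 1 < t n) (hlim : Tendsto t atTop (𝓝 1)) :
    Tendsto (fun n => (V x - V (t n • x)) / (t n - 1)) atTop
      (𝓝 (-inner ℝ x (gradient V x))) := by
  simpa using tendsto_sub_div_of_hasDerivAt (hasDerivAt_comp_smul hV x 1) ht hlim

theorem measurable_inner_gradient (hV : ContDiff ℝ 1 V) :
    Measurable fun x => inner ℝ x (gradient V x) := by
  have h : Continuous (gradient V) :=
    (InnerProductSpace.toDual ℝ (Space d)).symm.continuous.comp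
      (hV.continuous_fderiv one_ne_zero)
  exact (continuous_id.inner h).measurable

end Potential

/-! ### The virial identity and the conclusion. -/

/-- An eigenvector of `Ψ(p²/2) + V` satisfies the virial identity
`⟨ψ, p² Ψ'(p²/2) ψ⟩ = ⟨ψ, (x · ∇V) ψ⟩`, and both sides are finite. -/
theorem virial_identity {Ψ : ℝ → ℝ} {V : Space d → ℝ} {c c₂ d₂ : ℝ}
    (hΨ_C1 : ContDiffOn ℝ 1 Ψ (Ioi 0)) (hΨ_nonneg : ∀ u, 0 ≤ u → 0 ≤ Ψ u)
    (hΨ_deriv_nonneg : ∀ u, 0 < u → 0 ≤ deriv Ψ u) (hΨ_lim : Tendsto Ψ (𝓝[>] 0) (𝓝 0))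
    (hΨ_zero : Ψ 0 = 0) (hc₂ : 0 ≤ c₂) (hd₂ : 0 ≤ d₂)
    (hΨ_upper : ∀ u, 0 < u → u * deriv Ψ u ≤ c₂ * Ψ u + d₂) (hV : ContDiff ℝ 1 V)
    (hgrad : ∀ x, ‖x‖ * ‖gradient V x‖ ≤ c) {ψ G W : L2 d} {E : ℝ}
    (hG : G =ᵐ[volume] fun ξ => (kineticSymbol d Ψ ξ : ℂ) * fourierL2 d ψ ξ)
    (hW : W =ᵐ[volume] fun x => (V x : ℂ) * ψ x)
    (heq : (fourierL2 d).symm G + W = (E : ℂ) • ψ) :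
    Integrable (fun ξ : Space d => 2 * (‖(2 * Real.pi) • ξ‖ ^ 2 / 2) *
        deriv Ψ (‖(2 * Real.pi) • ξ‖ ^ 2 / 2) * ‖fourierL2 d ψ ξ‖ ^ 2) ∧
      Integrable (fun x => inner ℝ x (gradient V x) * ‖ψ x‖ ^ 2) ∧
      ∫ ξ : Space d, 2 * (‖(2 * Real.pi) • ξ‖ ^ 2 / 2) *
        deriv Ψ (‖(2 * Real.pi) • ξ‖ ^ 2 / 2) * ‖fourierL2 d ψ ξ‖ ^ 2 =
          ∫ x, inner ℝ x (gradient V x) * ‖ψ x‖ ^ 2 := by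
  set f := fourierL2 d ψ
  set u : Space d → ℝ := fun ξ => ‖(2 * Real.pi) • ξ‖ ^ 2 / 2
  have hu0 ξ : 0 ≤ u ξ := by positivity
  have hg : Continuous (kineticSymbol d Ψ) :=
    continuous_kineticSymbol (continuousOn_Ici_of_contDiffOn hΨ_C1 hΨ_lim hΨ_zero)
  have hgu ξ : kineticSymbol d Ψ ξ = Ψ (u ξ) := rfl
  set t : ℕ → ℝ := fun n => 1 + 1 / ((n : ℝ) + 1) with ht_def
  have ht n : 1 < t n := lt_add_of_pos_right 1 (by positivity)
  have ht0 n : t n ≠ 0 := (zero_lt_one.trans (ht n)).ne'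
  have hlim : Tendsto t atTop (𝓝 1) := by
    simpa [ht_def] using (tendsto_one_div_add_atTop_nhds_zero_nat (𝕜 := ℝ)).const_add 1
  -- This majorant is in `L²` because `Ψ(p²/2)ψ`, whose Fourier transform is `G`, is.
  set K₁ : Space d → ℝ := fun ξ => 2 * (c₂ * (kineticSymbol d Ψ ξ * ‖f ξ‖) + d₂ * ‖f ξ‖)
  have hK₁ : MemLp K₁ 2 (volume : Measure (Space d)) := by
    have h1 : MemLp (fun ξ => kineticSymbol d Ψ ξ * ‖f ξ‖) 2 (volume : Measure (Space d)) := by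
      refine (Lp.memLp G).norm.ae_eq ?_
      filter_upwards [hG] with ξ h
      rw [h, norm_mul, Complex.norm_real, hgu, Real.norm_of_nonneg (hΨ_nonneg _ (hu0 ξ))]
    exact ((h1.const_mul c₂).add ((Lp.memLp f).norm.const_mul d₂)).const_mul 2
  set K₂ : Space d → ℝ := fun x => c * ‖ψ x‖
  have hK₂ : MemLp K₂ 2 (volume : Measure (Space d)) := (Lp.memLp ψ).norm.const_mul c
  set m₁ : ℕ → Space d → ℝ := fun n ξ =>
    (kineticSymbol d Ψ ξ - kineticSymbol d Ψ ((t n)⁻¹ • ξ)) / (t n - 1)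
  set m₂ : ℕ → Space d → ℝ := fun n x => (V x - V (t n • x)) / (t n - 1)
  have hm₁ n : Measurable (m₁ n) :=
    (show Continuous (m₁ n) by fun_prop).measurable
  have hm₂ n : Measurable (m₂ n) := by
    have := hV.continuous
    exact (show Continuous (m₂ n) by fun_prop).measurable
  have hmK₁ n ξ : |m₁ n ξ| * ‖f ξ‖ ≤ K₁ ξ := by
    have h1 : |m₁ n ξ| ≤ 2 * (c₂ * kineticSymbol d Ψ ξ + d₂) := by
      rw [abs_div, abs_of_pos (sub_pos.mpr (ht n)), div_le_iff₀ (sub_pos.mpr (ht n)),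
        kineticSymbol_smul]
      exact abs_sub_comp_inv_sq_le hΨ_C1 hΨ_nonneg hΨ_deriv_nonneg hc₂ hd₂ hΨ_upper (hu0 ξ)
        (ht n).le
    calc |m₁ n ξ| * ‖f ξ‖ ≤ 2 * (c₂ * kineticSymbol d Ψ ξ + d₂) * ‖f ξ‖ := by gcongr
      _ = K₁ ξ := by ring
  have hmK₂ n x : |m₂ n x| * ‖ψ x‖ ≤ K₂ x := by
    have h1 : |m₂ n x| ≤ c := by
      rw [abs_div, abs_of_pos (sub_pos.mpr (ht n)), div_le_iff₀ (sub_pos.mpr (ht n))]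
      exact abs_sub_comp_smul_le hV hgrad x (ht n).le
    exact mul_le_mul_of_nonneg_right h1 (norm_nonneg _)
  have hlim₁ ξ : Tendsto (fun n => m₁ n ξ) atTop (𝓝 (2 * u ξ * deriv Ψ (u ξ))) := by
    simp only [m₁, kineticSymbol_smul]
    exact tendsto_sub_comp_inv_sq_div hΨ_C1 (hu0 ξ) ht hlim
  have hlim₂ x : Tendsto (fun n => m₂ n x) atTop (𝓝 (-inner ℝ x (gradient V x))) :=
    tendsto_sub_comp_smul_div hV x ht hlim
  have hφ : Tendsto (fun n => dilation (t n) (ht0 n) ψ) atTop (𝓝 ψ) := tendsto_dilation ψ ht hlim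
  have hφF := ((fourierL2 d).continuous.tendsto ψ).comp hφ
  have hT := (tendsto_integral_mul_inner hm₁ hK₁ hmK₁ hlim₁ hφF).add
    (tendsto_integral_mul_inner hm₂ hK₂ hmK₂ hlim₂ hφ)
  have hzero n : (∫ ξ, (m₁ n ξ : ℂ) *
      inner ℂ (((fourierL2 d) ∘ fun n => dilation (t n) (ht0 n) ψ) n ξ) (f ξ)) +
      ∫ x, (m₂ n x : ℂ) * inner ℂ (dilation (t n) (ht0 n) ψ x) (ψ x) = 0 := by
    have h := integral_sub_dilation_of_eigen hG hW heq (ht0 n)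
    simp only [m₁, m₂, Complex.ofReal_div, div_mul_eq_mul_div, integral_div, Function.comp_apply]
    rw [← add_div, h, zero_div]
  have hsum := tendsto_nhds_unique hT
    (tendsto_const_nhds.congr fun n => (hzero n).symm)
  -- The limiting multiplier inherits the majorant `K₁` pointwise, so the virial integral is finite.
  have hI₁ := integrable_mul_norm_sq (memLp_mul_of_dominated
    (show Measurable fun ξ => 2 * u ξ * deriv Ψ (u ξ) by
      have h1 : Measurable u := by fun_prop
      exact (h1.const_mul 2).mul ((measurable_deriv Ψ).comp h1)) hK₁
    (fun ξ => le_of_tendsto ((hlim₁ ξ).abs.mul_const _)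
      (Eventually.of_forall fun n => hmK₁ n ξ))).coeFn_toLp
  have hI₂ := integrable_mul_norm_sq (memLp_mul_of_dominated (measurable_inner_gradient hV) hK₂
    (fun x => mul_le_mul_of_nonneg_right ((abs_real_inner_le_norm _ _).trans (hgrad x))
      (norm_nonneg _))).coeFn_toLp
  refine ⟨hI₁, hI₂, ?_⟩
  have hreal : (∫ ξ, 2 * u ξ * deriv Ψ (u ξ) * ‖f ξ‖ ^ 2) +
      ∫ x, -inner ℝ x (gradient V x) * ‖ψ x‖ ^ 2 = 0 := by exact_mod_cast hsum
  simp only [neg_mul, integral_neg] at hreal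
  linarith

theorem exists_eigen_data {Ψ : ℝ → ℝ} {V : Space d → ℝ} {z : ℂ}
    (h : IsEigenvalue (schrodingerOp Ψ V) z) :
    ∃ ψ G W : L2 d, ψ ≠ 0 ∧
      (G =ᵐ[volume] fun ξ => (kineticSymbol d Ψ ξ : ℂ) * fourierL2 d ψ ξ) ∧
      (W =ᵐ[volume] fun x => (V x : ℂ) * ψ x) ∧ (fourierL2 d).symm G + W = z • ψ := by
  obtain ⟨ψ, hψ, heq⟩ := h
  exact ⟨ψ, mulFun (kineticSymbol d Ψ) ⟨fourierL2 d ψ, ψ.2.1⟩, mulFun V ⟨ψ, ψ.2.2⟩, hψ,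
    mulFun_ae _ _, mulFun_ae _ _, heq⟩

end NonlocalSchrodinger

end

theorem theorem3p6 (d : ℕ) (Ψ : ℝ → ℝ) (V : NonlocalSchrodinger.Space d → ℝ)
    (μ c₂ d₂ c γ : ℝ)
    -- `Ψ` is `C¹` on `(0,∞)`, nonnegative, nondecreasing, with `Ψ(+0) = Ψ(0) = 0`
    (hΨ_C1 : ContDiffOn ℝ 1 Ψ (Ioi 0))
    (hΨ_nonneg : ∀ u, 0 ≤ u → 0 ≤ Ψ u)
    (hΨ_deriv_nonneg : ∀ u, 0 < u → 0 ≤ deriv Ψ u)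
    (hΨ_lim : Tendsto Ψ (𝓝[>] 0) (𝓝 0))
    (hΨ_zero : Ψ 0 = 0)
    -- `u Ψ'(u) ≤ c₂ Ψ(u) + d₂` (at `u = 0` both this and the next bound are trivial)
    (hc₂ : 0 ≤ c₂) (hd₂ : 0 ≤ d₂)
    (hΨ_upper : ∀ u, 0 < u → u * deriv Ψ u ≤ c₂ * Ψ u + d₂)
    -- `2 u Ψ'(u) ≥ μ Ψ(u)`
    (hμ : 0 < μ)
    (hΨ_lower : ∀ u, 0 < u → μ * Ψ u ≤ 2 * u * deriv Ψ u)
    -- `V` is `C¹` and decays together with its gradient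
    (hV_C1 : ContDiff ℝ 1 V)
    (hc : 0 < c) (hγ : 0 < γ)
    (hV_decay : ∀ x, |V x| ≤ c * NonlocalSchrodinger.bracket x ^ (-γ))
    (hV_grad_decay : ∀ x, ‖gradient V x‖ ≤ c * NonlocalSchrodinger.bracket x ^ (-1 - γ))
    -- `-μ V - x·∇V ≥ 0`
    (hV_virial : ∀ x, 0 ≤ -μ * V x - inner ℝ x (gradient V x)) :
    ∀ E : ℝ, 0 < E →
      ¬ NonlocalSchrodinger.IsEigenvalue (NonlocalSchrodinger.schrodingerOp Ψ V) (E : ℂ) := by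
  open NonlocalSchrodinger in
  intro E hE hEig
  obtain ⟨ψ, G, W, hψ, hG, hW, heq⟩ := exists_eigen_data hEig
  obtain ⟨hI₁, hI₂, hvir⟩ := virial_identity hΨ_C1 hΨ_nonneg hΨ_deriv_nonneg hΨ_lim hΨ_zero hc₂ hd₂
    hΨ_upper hV_C1 (norm_mul_norm_gradient_le hc.le hγ.le hV_grad_decay) hG hW heq
  have henergy := integral_mul_norm_sq_of_eigen hG hW heq
  have hkin : μ * ∫ ξ, kineticSymbol d Ψ ξ * ‖fourierL2 d ψ ξ‖ ^ 2 ≤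
      ∫ ξ : Space d, 2 * (‖(2 * Real.pi) • ξ‖ ^ 2 / 2) *
        deriv Ψ (‖(2 * Real.pi) • ξ‖ ^ 2 / 2) * ‖fourierL2 d ψ ξ‖ ^ 2 := by
    rw [← integral_const_mul]
    refine integral_mono ((integrable_mul_norm_sq hG).const_mul μ) hI₁ fun ξ => ?_
    simp only [← mul_assoc μ]
    refine mul_le_mul_of_nonneg_right ?_ (sq_nonneg _)
    -- At zero momentum both sides vanish, whatever value `deriv Ψ 0` takes.
    rcases (show 0 ≤ ‖(2 * Real.pi) • ξ‖ ^ 2 / 2 by positivity).eq_or_lt with h | h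
    · rw [kineticSymbol, ← h, hΨ_zero]
      simp
    · exact hΨ_lower _ h
  have hpot : ∫ x, inner ℝ x (gradient V x) * ‖ψ x‖ ^ 2 ≤ -μ * ∫ x, V x * ‖ψ x‖ ^ 2 := by
    rw [← integral_const_mul]
    refine integral_mono hI₂ ((integrable_mul_norm_sq hW).const_mul (-μ)) fun x => ?_
    simp only [← mul_assoc (-μ)]
    exact mul_le_mul_of_nonneg_right (sub_nonneg.mp (hV_virial x)) (sq_nonneg _)
  have hpos : 0 < μ * (E * ‖ψ‖ ^ 2) := by
    have := norm_pos_iff.mpr hψ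
    positivity
  rw [← henergy] at hpos
  linarith
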